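/- For $m\in\mathbb N=\{0,1,2,\dots\}$ and an integer $p\ge 2$ let $$\zeta(\{p\}^m)=\sum_{1\le N_1<\cdots<N_m}\frac{1}{N_1^{p}\cdots N_m^{p}},$$ where the sum is over all strictly increasing $m$-tuples of positive integers, so that $\zeta(\{p\}^0)=1$; this series converges. Let $\zeta(s)$ be the Riemann zeta function and $B_j$ the Bernoulli numbers. Below, $\sum_{\sum i y_i=m}$ denotes the sum over all partitions of $m$, where $y_i\ge 0$ $(1\le i\le m)$ is the multiplicity of the part $i$, so that $\sum_{i=1}^m i\,y_i=m$. **Theorem 5.3.** For every $m\in\mathbb N$, $$\zeta(\{2\}^m)=(-1)^m\sum_{\sum i y_i=m}\ \prod_{i=1}^m\frac{(-1)^{y_i}}{y_i!\,i^{y_i}}\,\zeta(2i)^{y_i}=\frac{\pi^{2m}}{(2m+1)!}$$ and $$\sum_{\sum i y_i=m}\ \prod_{i=1}^m\frac1{y_i!}\left(\frac{B_{2i}}{(2i)\,(2i)!}\right)^{y_i}=\frac1{2^{2m}\,(2m+1)!}.$$ Moreover (Theorem 5.4), for every integer $p\ge2$, $\zeta(\{p\}^m)\to0$ as $m\to\infty$.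 -/

import Mathlib

/-- The index set of a multiple series of depth `m`: the tuples of natural numbers
`1 ≤ N₁ < N₂ < ⋯ < N_m` (for `m = 0` there is exactly one, the empty tuple). -/
def IncreasingTuple (m : ℕ) : Type :=
  {N : Fin m → ℕ // (∀ i, 1 ≤ N i) ∧ StrictMono N}

/-- The term `1 / (N₁ ^ s₁ ⋯ N_m ^ s_m)` of the multiple zeta series. -/
noncomputable def multipleZetaTerm {m : ℕ} (s : Fin m → ℕ) (N : IncreasingTuple m) : ℝ :=
  ∏ i, 1 / (N.1 i : ℝ) ^ s i

/-- The multiple zeta value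
`ζ(s₁, …, s_m) = ∑_{1 ≤ N₁ < ⋯ < N_m} 1 / (N₁ ^ s₁ ⋯ N_m ^ s_m)`.
As for every `tsum`, this is meaningful only when the series converges. -/
noncomputable def multipleZeta {m : ℕ} (s : Fin m → ℕ) : ℝ :=
  ∑' N : IncreasingTuple m, multipleZetaTerm s N

/-- The multiplicity of `i` as a part of the partition `P` of `m`. -/
def partMult {m : ℕ} (P : Nat.Partition m) (i : ℕ) : ℕ :=
  P.parts.count i

/-! `ζ({p}^m)` is the elementary symmetric function `e_m` of the numbers `1/n^p`. For `p = 2` their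
power sums are `ζ(2k)`, and Newton's identities say that `c_m = (-1)^m e_m` satisfies `m c_m = ∑ k
a_k c_{m-k}` with `a_k = -ζ(2k)/k`. Partition sums obey the same recurrence (`mul_partitionExpSum`),
and it determines `c` from `c_0 = 1`. Euler's sine product gives the closed form
(`esymmTsum_one_div_succ_sq`), and his formula for `ζ(2k)` then gives the Bernoulli identity. The
limit holds because `∑ e_m` converges. -/

open Finset Filter Topology

/-! ### Partition sums and their recurrence. -/

section PartitionSums

variable {K : Type*} [Field K] [CharZero K]

/-- The sum over the partitions of `m` of the products `∏ a i ^ y i / (y i)!`, that is the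
coefficient of `X ^ m` in `exp (∑ a i X ^ i)`. -/
noncomputable def partitionExpSum (a : ℕ → K) (m : ℕ) : K :=
  ∑ P : Nat.Partition m, ∏ i ∈ Icc 1 m,
    1 / (Nat.factorial (P.parts.count i) : K) * a i ^ P.parts.count i

theorem prod_count_eq_of_le (a : ℕ → K) {m n : ℕ} (hmn : m ≤ n) (P : Nat.Partition m) :
    ∏ i ∈ Icc 1 m, 1 / (Nat.factorial (P.parts.count i) : K) * a i ^ P.parts.count i =
      ∏ i ∈ Icc 1 n, 1 / (Nat.factorial (P.parts.count i) : K) * a i ^ P.parts.count i := by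
  refine Finset.prod_subset (Icc_subset_Icc_right hmn) fun i _ hi => ?_
  have : P.parts.count i = 0 := by
    rw [Multiset.count_eq_zero]
    intro h
    exact hi (mem_Icc.2 ⟨P.parts_pos h, P.le_of_mem_parts h⟩)
  simp [this]

theorem succ_count_mul_prod_cons (a : ℕ → K) (s : Multiset ℕ) {k : ℕ} {T : Finset ℕ}
    (hk : k ∈ T) :
    ((k ::ₘ s).count k : K) * ∏ i ∈ T, 1 / (Nat.factorial ((k ::ₘ s).count i) : K) *
        a i ^ (k ::ₘ s).count i =
      a k * ∏ i ∈ T, 1 / (Nat.factorial (s.count i) : K) * a i ^ s.count i := by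
  rw [← mul_prod_erase T _ hk, ← mul_prod_erase T (fun i => 1 / (Nat.factorial (s.count i) : K) * _) hk,
    ← mul_assoc, ← mul_assoc, ← mul_assoc (a k)]
  congr 1
  · rw [Multiset.count_cons_self, Nat.factorial_succ, pow_succ]
    have h1 : ((s.count k + 1 : ℕ) : K) ≠ 0 := Nat.cast_ne_zero.2 (Nat.succ_ne_zero _)
    have h2 : (Nat.factorial (s.count k) : K) ≠ 0 := Nat.cast_ne_zero.2 (Nat.factorial_ne_zero _)
    push_cast at h1 ⊢
    field_simp
  · refine Finset.prod_congr rfl fun i hi => ?_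
    rw [Multiset.count_cons_of_ne (ne_of_mem_erase hi)]

/-- Removing one part `k` matches the partitions of `m` containing `k` with the partitions of `m -
k`; the other partitions contribute zero. -/
theorem sum_count_mul_prod (a : ℕ → K) {m k : ℕ} (hk1 : 1 ≤ k) (hk : k ≤ m) :
    ∑ P : Nat.Partition m, (P.parts.count k : K) * ∏ i ∈ Icc 1 m,
        1 / (Nat.factorial (P.parts.count i) : K) * a i ^ P.parts.count i =
      a k * partitionExpSum a (m - k) := by
  classical
  rw [partitionExpSum, mul_sum]
  have h0 : ∀ P : Nat.Partition m, P ∉ univ.filter (fun P : Nat.Partition m => k ∈ P.parts) →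
      (P.parts.count k : K) * ∏ i ∈ Icc 1 m,
        1 / (Nat.factorial (P.parts.count i) : K) * a i ^ P.parts.count i = 0 := by
    intro P hP
    rw [Multiset.count_eq_zero.2 (by simpa using hP)]
    simp
  rw [← Finset.sum_subset (subset_univ _) fun P _ hP => h0 P hP,
    ← Finset.sum_subtype_eq_sum_filter, Finset.subtype_univ]
  refine Fintype.sum_equiv (Nat.Partition.partitionWithPartEquiv hk1 hk) _ _ fun P => ?_
  rw [prod_count_eq_of_le a (Nat.sub_le m k), Nat.Partition.partitionWithPartEquiv_apply_parts,
    ← succ_count_mul_prod_cons a _ (mem_Icc.2 ⟨hk1, hk⟩), Multiset.cons_erase P.2]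

/-- Coefficient form of `X E' = (X A') E` for `E = exp A`, proved by writing `m` as the sum of the
parts of each partition. -/
theorem mul_partitionExpSum (a : ℕ → K) (m : ℕ) :
    (m : K) * partitionExpSum a m = ∑ k ∈ Icc 1 m, k * a k * partitionExpSum a (m - k) := by
  have hcount (P : Nat.Partition m) : (m : K) = ∑ k ∈ Icc 1 m, (k : K) * P.parts.count k := by
    have h : ∑ k ∈ Icc 1 m, k * P.parts.count k = m := by
      conv_rhs => rw [← P.parts_sum, Finset.sum_multiset_count_of_subset P.parts (Icc 1 m)
        fun i hi => mem_Icc.2 ⟨P.parts_pos (Multiset.mem_toFinset.1 hi),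
          P.le_of_mem_parts (Multiset.mem_toFinset.1 hi)⟩]
      simp [mul_comm]
    exact_mod_cast h.symm
  rw [partitionExpSum, mul_sum, sum_congr rfl fun P _ => by rw [hcount P, sum_mul], sum_comm]
  refine sum_congr rfl fun k hk => ?_
  rw [mul_assoc, ← sum_count_mul_prod a (mem_Icc.1 hk).1 (mem_Icc.1 hk).2, mul_sum]
  simp only [mul_assoc]

theorem eq_partitionExpSum_of_recurrence (a c : ℕ → K) (h0 : c 0 = 1)
    (h : ∀ m : ℕ, 1 ≤ m → (m : K) * c m = ∑ k ∈ Icc 1 m, k * a k * c (m - k)) (m : ℕ) :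
    c m = partitionExpSum a m := by
  induction m using Nat.strong_induction_on with
  | _ m ih =>
    rcases Nat.eq_zero_or_pos m with rfl | hm
    · simp [partitionExpSum, h0]
    · refine mul_left_cancel₀ (Nat.cast_ne_zero.2 hm.ne' : (m : K) ≠ 0) ?_
      rw [h m hm, mul_partitionExpSum]
      refine sum_congr rfl fun k hk => ?_
      rw [ih (m - k) (by have := mem_Icc.1 hk; omega)]

end PartitionSums

/-! ### Newton's identities and infinite elementary symmetric functions. -/

theorem newton_powersetCard {R : Type*} [CommRing R] (f : ℕ → R) (N m : ℕ) :
    (m : R) * ∑ S ∈ powersetCard m (range N), ∏ n ∈ S, f n =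
      (-1) ^ (m + 1) * ∑ a ∈ antidiagonal m with a.1 < m,
        (-1) ^ a.1 * (∑ S ∈ powersetCard a.1 (range N), ∏ n ∈ S, f n) *
          ∑ n ∈ range N, f n ^ a.2 := by
  have he (k : ℕ) : MvPolynomial.aeval (fun i : range N => f i)
      (MvPolynomial.esymm (range N) R k) = ∑ S ∈ powersetCard k (range N), ∏ n ∈ S, f n := by
    rw [MvPolynomial.aeval_esymm_eq_multiset_esymm, ← Finset.esymm_map_val]
    congr 1
    exact Multiset.attach_map_val' (range N).val f
  have hp (k : ℕ) : MvPolynomial.aeval (fun i : range N => f i)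
      (MvPolynomial.psum (range N) R k) = ∑ n ∈ range N, f n ^ k := by
    simp only [MvPolynomial.psum, map_sum, map_pow, MvPolynomial.aeval_X]
    exact Finset.sum_coe_sort (range N) fun n => f n ^ k
  have h := congrArg (MvPolynomial.aeval fun i : range N => f i)
    (MvPolynomial.mul_esymm_eq_sum (range N) R m)
  simpa only [map_mul, map_natCast, map_sum, map_pow, map_neg, map_one, he, hp] using h

section InfiniteElementarySymmetric

variable {R : Type*} [NormedCommRing R] [NormOneClass R] [CompleteSpace R]

/-- The elementary symmetric function of degree `k` of a sequence. -/
noncomputable def esymmTsum (f : ℕ → R) (k : ℕ) : R :=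
  ∑' S : {S : Finset ℕ // S.card = k}, ∏ n ∈ S.1, f n

theorem summable_prod_card_eq {f : ℕ → R} (hf : Summable fun n => ‖f n‖) (k : ℕ) :
    Summable fun S : {S : Finset ℕ // S.card = k} => ∏ n ∈ S.1, f n :=
  (summable_finsetProd_of_summable_norm hf).comp_injective Subtype.val_injective

theorem tendsto_sum_powersetCard {f : ℕ → R} (hf : Summable fun n => ‖f n‖) (k : ℕ) :
    Tendsto (fun N => ∑ S ∈ powersetCard k (range N), ∏ n ∈ S, f n) atTop
      (𝓝 (esymmTsum f k)) := by
  have h := (hasSum_subtype_iff_indicator (f := fun S : Finset ℕ => ∏ n ∈ S, f n)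
    (s := {S | S.card = k})).1 (summable_prod_card_eq hf k).hasSum
  refine ((h.comp tendsto_finset_powerset_atTop_atTop).comp tendsto_finset_range).congr fun N => ?_
  simp only [Function.comp_apply, Set.indicator_apply, Set.mem_ofPred_eq]
  rw [← sum_filter, ← powersetCard_eq_filter]

theorem hasSum_esymmTsum {f : ℕ → R} (hf : Summable fun n => ‖f n‖) :
    HasSum (esymmTsum f) (∑' S : Finset ℕ, ∏ n ∈ S, f n) := by
  have h := (summable_finsetProd_of_summable_norm hf).hasSum
  rw [← (Equiv.sigmaFiberEquiv (Finset.card : Finset ℕ → ℕ)).hasSum_iff] at h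
  exact h.sigma fun k => (summable_prod_card_eq hf k).hasSum

theorem newton_esymmTsum {f : ℕ → R} (hf : Summable fun n => ‖f n‖) (m : ℕ) :
    (m : R) * esymmTsum f m =
      (-1) ^ (m + 1) * ∑ a ∈ antidiagonal m with a.1 < m,
        (-1) ^ a.1 * esymmTsum f a.1 * ∑' n, f n ^ a.2 := by
  have hpow {k : ℕ} (hk : k ≠ 0) : Summable fun n => f n ^ k := by
    have h1 : Summable fun n => ‖f n‖ ^ k := by
      refine hf.of_norm_bounded_eventually_nat ?_
      filter_upwards [hf.tendsto_atTop_zero.eventually_le_const one_pos] with n hn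
      rw [Real.norm_of_nonneg (by positivity)]
      exact pow_le_of_le_one (norm_nonneg _) hn hk
    exact h1.of_norm_bounded fun n => norm_pow_le' _ (Nat.pos_of_ne_zero hk)
  refine tendsto_nhds_unique ((tendsto_sum_powersetCard hf m).const_mul _) ?_
  simp only [newton_powersetCard]
  refine Tendsto.const_mul _ (tendsto_finsetSum _ fun a ha => ?_)
  refine ((tendsto_sum_powersetCard hf _).const_mul _).mul
    -- The restriction `a.1 < m` excludes the exponent `0`, whose power sum would diverge.
    (hpow ?_).hasSum.tendsto_sum_nat
  simp only [mem_filter, HasAntidiagonal.mem_antidiagonal] at ha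
  omega

/-- Expand the product over finite sets of indices and group them by cardinality. -/
theorem hasSum_pow_mul_esymmTsum {f : ℕ → R} (hf : Summable fun n => ‖f n‖) {t F : R}
    (hF : Tendsto (fun N => ∏ n ∈ range N, (1 + t * f n)) atTop (𝓝 F)) :
    HasSum (fun k => t ^ k * esymmTsum f k) F := by
  have htf : Summable fun n => ‖t * f n‖ :=
    (hf.mul_left ‖t‖).of_nonneg_of_le (fun _ => norm_nonneg _) fun n => norm_mul_le _ _
  have h := hasSum_esymmTsum htf
  have hprod := (hasProd_one_add_of_hasSum_prod
    (summable_finsetProd_of_summable_norm htf).hasSum).comp tendsto_finset_range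
  rw [tendsto_nhds_unique hprod hF] at h
  convert h using 2 with k
  rw [esymmTsum, esymmTsum, ← (summable_prod_card_eq hf k).tsum_mul_left]
  refine tsum_congr fun S => ?_
  rw [prod_mul_distrib, prod_const, S.2]

end InfiniteElementarySymmetric
theorem eq_of_hasSum_pow_mul {c d : ℕ → ℂ} {F : ℂ → ℂ}
    (hc : ∀ t, HasSum (fun k => t ^ k * c k) (F t))
    (hd : ∀ t, HasSum (fun k => t ^ k * d k) (F t)) : c = d := by
  have key {c : ℕ → ℂ} (hc : ∀ t, HasSum (fun k => t ^ k * c k) (F t)) :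
      HasFPowerSeriesAt F (FormalMultilinearSeries.ofScalars ℂ c) 0 := by
    refine hasFPowerSeriesAt_iff.2 (Eventually.of_forall fun t => ?_)
    simpa [FormalMultilinearSeries.coeff_ofScalars] using hc t
  funext k
  have h := congrArg (fun p : FormalMultilinearSeries ℂ ℂ ℂ => p.coeff k)
    ((key hc).eq_formalMultilinearSeries (key hd))
  simpa [FormalMultilinearSeries.coeff_ofScalars] using h

/-! ### Euler's sine product and zeta values. -/

theorem summable_one_div_succ_pow {p : ℕ} (hp : 2 ≤ p) :
    Summable fun n : ℕ => 1 / ((n : ℝ) + 1) ^ p := by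
  simpa using (summable_nat_add_iff 1).2 (Real.summable_one_div_nat_pow.2 (show 1 < p by omega))

theorem summable_norm_one_div_succ_pow {p : ℕ} (hp : 2 ≤ p) :
    Summable fun n : ℕ => ‖1 / ((n : ℝ) + 1) ^ p‖ :=
  (summable_one_div_succ_pow hp).norm

theorem summable_norm_one_div_succ_sq :
    Summable fun n : ℕ => ‖1 / ((n : ℂ) + 1) ^ 2‖ := by
  refine (summable_norm_one_div_succ_pow le_rfl).congr fun n => ?_
  rw [← Complex.norm_real]
  push_cast
  rfl

theorem esymmTsum_one_div_succ_sq (m : ℕ) :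
    esymmTsum (fun n : ℕ => 1 / ((n : ℂ) + 1) ^ 2) m =
      (Real.pi : ℂ) ^ (2 * m) / (Nat.factorial (2 * m + 1) : ℂ) := by
  have hpi : (Real.pi : ℂ) ≠ 0 := Complex.ofReal_ne_zero.2 Real.pi_ne_zero
  have key (t : ℂ) : ∃ F, HasSum
        (fun k => t ^ k * esymmTsum (fun n : ℕ => 1 / ((n : ℂ) + 1) ^ 2) k) F ∧
      HasSum (fun k => t ^ k * ((Real.pi : ℂ) ^ (2 * k) / (Nat.factorial (2 * k + 1) : ℂ))) F := by
    -- The value `sin(πz)/(πz)` is `0/0` at `t = 0`.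
    rcases eq_or_ne t 0 with rfl | ht
    · refine ⟨1, ?_, ?_⟩
      · exact hasSum_pow_mul_esymmTsum summable_norm_one_div_succ_sq (by simp)
      · convert hasSum_single (f := fun k : ℕ => (0 : ℂ) ^ k *
          ((Real.pi : ℂ) ^ (2 * k) / (Nat.factorial (2 * k + 1) : ℂ))) 0 ?_ using 1
        · simp
        · intro k hk
          simp [hk]
    -- With `z² = -t`, Euler's factors `1 - z²/n²` become `1 + t/n²`.
    · obtain ⟨z, hz⟩ := IsAlgClosed.exists_pow_nat_eq (-t) two_pos
      have hz0 : z ≠ 0 := by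
        rintro rfl
        exact ht (by simpa using hz)
      refine ⟨Complex.sin (Real.pi * z) / (Real.pi * z),
        hasSum_pow_mul_esymmTsum summable_norm_one_div_succ_sq ?_, ?_⟩
      · refine ((Complex.tendsto_euler_sin_prod z).div_const (Real.pi * z)).congr fun N => ?_
        rw [mul_div_cancel_left₀ _ (mul_ne_zero hpi hz0)]
        refine prod_congr rfl fun n _ => ?_
        rw [hz]
        ring
      · refine ((Complex.hasSum_sin (Real.pi * z)).div_const (Real.pi * z)).congr_fun fun k => ?_
        rw [show t = -z ^ 2 by rw [hz, neg_neg], neg_pow, ← pow_mul, pow_succ, mul_pow]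
        field_simp
  choose F hF using key
  exact congrFun (eq_of_hasSum_pow_mul (fun t => (hF t).1) fun t => (hF t).2) m

theorem tsum_one_div_succ_sq_pow {k : ℕ} (hk : 1 ≤ k) :
    ∑' n : ℕ, (1 / ((n : ℂ) + 1) ^ 2) ^ k = riemannZeta (2 * (k : ℂ)) := by
  have h : (2 * (k : ℂ)) = ((2 * k : ℕ) : ℂ) := by push_cast; rfl
  have hre : 1 < (((2 * k : ℕ) : ℂ)).re := by
    rw [Complex.natCast_re]
    exact_mod_cast (by omega : 1 < 2 * k)
  rw [h, zeta_eq_tsum_one_div_nat_add_one_cpow hre]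
  refine tsum_congr fun n => ?_
  rw [Complex.cpow_natCast, div_pow, one_pow, ← pow_mul]

/-! ### Increasing tuples as finite sets. -/

/-- The strictly increasing tuple whose entries are the successors of the elements of `S`. -/
noncomputable def IncreasingTuple.ofFinset {m : ℕ} (S : {S : Finset ℕ // S.card = m}) :
    IncreasingTuple m :=
  ⟨fun i => S.1.orderEmbOfFin S.2 i + 1, fun _ => Nat.succ_pos _, fun _ _ hij =>
    Nat.succ_lt_succ ((S.1.orderEmbOfFin S.2).strictMono hij)⟩

theorem IncreasingTuple.ofFinset_bijective {m : ℕ} :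
    Function.Bijective (IncreasingTuple.ofFinset (m := m)) := by
  constructor
  · intro S T h
    have h' : ⇑(S.1.orderEmbOfFin S.2) = T.1.orderEmbOfFin T.2 := by
      funext i
      exact Nat.succ_injective (congrFun (congrArg Subtype.val h) i)
    refine Subtype.ext (Finset.coe_injective ?_)
    rw [← range_orderEmbOfFin S.1 S.2, ← range_orderEmbOfFin T.1 T.2, h']
  · intro N
    have hmono : StrictMono fun i => N.1 i - 1 := fun i j hij => by
      have h1 := N.2.2 hij
      have h2 := N.2.1 i
      simp only
      omega
    refine ⟨⟨univ.image fun i => N.1 i - 1, ?_⟩, Subtype.ext (funext fun i => ?_)⟩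
    · rw [card_image_of_injective _ hmono.injective, card_univ, Fintype.card_fin]
    · simp only [IncreasingTuple.ofFinset]
      rw [← orderEmbOfFin_unique (f := fun i => N.1 i - 1) _
        (fun i => mem_image_of_mem _ (mem_univ i)) hmono]
      exact Nat.sub_add_cancel (N.2.1 i)

theorem multipleZetaTerm_ofFinset {m : ℕ} (p : ℕ) (S : {S : Finset ℕ // S.card = m}) :
    multipleZetaTerm (fun _ => p) (IncreasingTuple.ofFinset S) =
      ∏ n ∈ S.1, 1 / ((n : ℝ) + 1) ^ p := by
  conv_rhs => rw [← map_orderEmbOfFin_univ S.1 S.2, prod_map]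
  simp [multipleZetaTerm, IncreasingTuple.ofFinset]

theorem summable_multipleZetaTerm {p : ℕ} (hp : 2 ≤ p) (m : ℕ) :
    Summable (multipleZetaTerm (fun _ : Fin m => p)) := by
  rw [← (Equiv.ofBijective _ IncreasingTuple.ofFinset_bijective).summable_iff]
  exact (summable_prod_card_eq (summable_norm_one_div_succ_pow hp) m).congr
    fun S => (multipleZetaTerm_ofFinset p S).symm

theorem multipleZeta_eq_esymmTsum (p m : ℕ) :
    multipleZeta (fun _ : Fin m => p) = esymmTsum (fun n : ℕ => 1 / ((n : ℝ) + 1) ^ p) m := by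
  rw [multipleZeta, esymmTsum,
    ← (Equiv.ofBijective _ IncreasingTuple.ofFinset_bijective).tsum_eq]
  exact tsum_congr (multipleZetaTerm_ofFinset p)

theorem ofReal_multipleZeta_two (m : ℕ) :
    ((multipleZeta (fun _ : Fin m => 2) : ℝ) : ℂ) =
      esymmTsum (fun n : ℕ => 1 / ((n : ℂ) + 1) ^ 2) m := by
  rw [multipleZeta_eq_esymmTsum, esymmTsum, esymmTsum, Complex.ofReal_tsum]
  push_cast
  rfl

/-! ### Partition formulas for zeta and Bernoulli values. -/

theorem neg_one_pow_mul_esymmTsum_eq_partitionExpSum (m : ℕ) :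
    (-1) ^ m * esymmTsum (fun n : ℕ => 1 / ((n : ℂ) + 1) ^ 2) m =
      partitionExpSum (fun k : ℕ => -riemannZeta (2 * (k : ℂ)) / k) m := by
  refine eq_partitionExpSum_of_recurrence _ (fun m => (-1) ^ m *
    esymmTsum (fun n : ℕ => 1 / ((n : ℂ) + 1) ^ 2) m) ?_ (fun m hm => ?_) m
  · rw [esymmTsum_one_div_succ_sq]
    simp
  · have h := newton_esymmTsum summable_norm_one_div_succ_sq m
    -- The signs combine to `(-1)^(2m+1) = -1`, the minus sign in `a_k`.
    rw [mul_left_comm, h, ← mul_assoc, ← pow_add, show m + (m + 1) = 2 * m + 1 by ring, pow_succ,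
      pow_mul, neg_one_sq, one_pow, one_mul, mul_sum]
    refine sum_bij' (fun a _ => a.2) (fun k _ => (m - k, k)) ?_ ?_ ?_ ?_ ?_
    · intro a ha
      simp only [mem_filter, HasAntidiagonal.mem_antidiagonal] at ha
      exact mem_Icc.2 ⟨by omega, by omega⟩
    · intro k hk
      have := mem_Icc.1 hk
      simp only [mem_filter, HasAntidiagonal.mem_antidiagonal]
      omega
    · intro a ha
      simp only [mem_filter, HasAntidiagonal.mem_antidiagonal] at ha
      exact Prod.ext (by simp only; omega) rfl
    · intro k _
      rfl
    · intro a ha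
      simp only [mem_filter, HasAntidiagonal.mem_antidiagonal] at ha
      have h1 : (a.2 : ℂ) ≠ 0 := Nat.cast_ne_zero.2 (by omega)
      rw [tsum_one_div_succ_sq_pow (by omega), show m - a.2 = a.1 by omega]
      field_simp

/-- Weighted homogeneity: it extracts the factor `(-(2π)²)^k` that Euler's formula puts into `a_k`.
-/
theorem partitionExpSum_pow_mul {K : Type*} [Field K] [CharZero K] (a : ℕ → K) (t : K) (m : ℕ) :
    partitionExpSum (fun k => t ^ k * a k) m = t ^ m * partitionExpSum a m := by
  refine (eq_partitionExpSum_of_recurrence _ (fun m => t ^ m * partitionExpSum a m) ?_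
    (fun m hm => ?_) m).symm
  · simp [partitionExpSum]
  · rw [mul_left_comm, mul_partitionExpSum, mul_sum]
    refine sum_congr rfl fun k hk => ?_
    rw [← pow_mul_pow_sub t (mem_Icc.1 hk).2]
    ring

theorem partitionExpSum_congr {K : Type*} [Field K] [CharZero K] {a b : ℕ → K} {m : ℕ}
    (h : ∀ k, 1 ≤ k → a k = b k) : partitionExpSum a m = partitionExpSum b m :=
  sum_congr rfl fun _ _ => prod_congr rfl fun i hi => by rw [h i (mem_Icc.1 hi).1]

theorem neg_riemannZeta_two_mul_div {k : ℕ} (hk : 1 ≤ k) :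
    -riemannZeta (2 * (k : ℂ)) / k = (-(2 * Real.pi) ^ 2 : ℂ) ^ k *
      (bernoulli (2 * k) / ((2 * (k : ℂ)) * (Nat.factorial (2 * k) : ℂ))) := by
  have h1 : (k : ℂ) ≠ 0 := Nat.cast_ne_zero.2 (by omega)
  have h2 : (Nat.factorial (2 * k) : ℂ) ≠ 0 := Nat.cast_ne_zero.2 (Nat.factorial_ne_zero _)
  have h3 : (2 : ℂ) ^ (2 * k) = 2 ^ (2 * k - 1) * 2 := by
    rw [← pow_succ, Nat.sub_add_cancel (by omega)]
  rw [riemannZeta_two_mul_nat (by omega), neg_pow ((2 * (Real.pi : ℂ)) ^ 2), ← pow_mul,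
    mul_pow, h3]
  field_simp
  ring

theorem partitionExpSum_bernoulli (m : ℕ) :
    partitionExpSum (fun k : ℕ => (bernoulli (2 * k) /
      ((2 * (k : ℚ)) * (Nat.factorial (2 * k) : ℚ)))) m =
        1 / ((2 : ℚ) ^ (2 * m) * (Nat.factorial (2 * m + 1) : ℚ)) := by
  have h := neg_one_pow_mul_esymmTsum_eq_partitionExpSum m
  rw [partitionExpSum_congr fun k hk => neg_riemannZeta_two_mul_div hk, partitionExpSum_pow_mul,
    esymmTsum_one_div_succ_sq, neg_pow ((2 * (Real.pi : ℂ)) ^ 2), ← pow_mul,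
    mul_pow, mul_assoc, mul_assoc] at h
  have hpi : (Real.pi : ℂ) ≠ 0 := Complex.ofReal_ne_zero.2 Real.pi_ne_zero
  have hf : (Nat.factorial (2 * m + 1) : ℂ) ≠ 0 := Nat.cast_ne_zero.2 (Nat.factorial_ne_zero _)
  have h' := mul_left_cancel₀ (pow_ne_zero m (neg_ne_zero.2 one_ne_zero)) h
  rw [mul_left_comm, div_eq_mul_inv] at h'
  have h'' := mul_left_cancel₀ (pow_ne_zero _ hpi) h'
  -- With the powers of `-1` and `π` cancelled, only rational numbers remain, so the complex
  -- identity descends to `ℚ`.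
  rw [← (Rat.cast_injective (α := ℂ)).eq_iff]
  have hcast : ((partitionExpSum (fun k : ℕ => (bernoulli (2 * k) /
      ((2 * (k : ℚ)) * (Nat.factorial (2 * k) : ℚ)))) m : ℚ) : ℂ) =
      partitionExpSum (fun k : ℕ => (bernoulli (2 * k) /
        ((2 * (k : ℂ)) * (Nat.factorial (2 * k) : ℂ)))) m := by
    simp only [partitionExpSum]
    push_cast
    rfl
  rw [hcast]
  push_cast
  rw [one_div, mul_inv, h'', inv_mul_cancel_left₀ (pow_ne_zero _ two_ne_zero)]

theorem tendsto_multipleZeta_atTop {p : ℕ} (hp : 2 ≤ p) :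
    Tendsto (fun m : ℕ => multipleZeta (fun _ : Fin m => p)) atTop (𝓝 0) := by
  simp only [multipleZeta_eq_esymmTsum]
  exact (hasSum_esymmTsum (summable_norm_one_div_succ_pow hp)).summable.tendsto_atTop_zero

theorem theorem5p3 :
    (∀ m : ℕ,
      Summable (multipleZetaTerm (fun _ : Fin m => 2)) ∧
      ((multipleZeta (fun _ : Fin m => 2) : ℝ) : ℂ) =
        (-1 : ℂ) ^ m * ∑ P : Nat.Partition m, ∏ i ∈ Finset.Icc 1 m,
          (-1 : ℂ) ^ partMult P i /
              ((Nat.factorial (partMult P i) : ℂ) * (i : ℂ) ^ partMult P i) *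
            riemannZeta (2 * (i : ℂ)) ^ partMult P i ∧
      multipleZeta (fun _ : Fin m => 2) =
        Real.pi ^ (2 * m) / (Nat.factorial (2 * m + 1) : ℝ) ∧
      ∑ P : Nat.Partition m, ∏ i ∈ Finset.Icc 1 m,
          1 / (Nat.factorial (partMult P i) : ℚ) *
            (bernoulli (2 * i) / ((2 * (i : ℚ)) * (Nat.factorial (2 * i) : ℚ))) ^ partMult P i =
        1 / ((2 : ℚ) ^ (2 * m) * (Nat.factorial (2 * m + 1) : ℚ))) ∧
    (∀ p : ℕ, 2 ≤ p →
      (∀ m : ℕ, Summable (multipleZetaTerm (fun _ : Fin m => p))) ∧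
      Filter.Tendsto (fun m : ℕ => multipleZeta (fun _ : Fin m => p))
        Filter.atTop (nhds 0)) := by
  refine ⟨fun m => ⟨summable_multipleZetaTerm le_rfl m, ?_, ?_, partitionExpSum_bernoulli m⟩,
    fun p hp => ⟨summable_multipleZetaTerm hp, tendsto_multipleZeta_atTop hp⟩⟩
  · have h : ∑ P : Nat.Partition m, ∏ i ∈ Finset.Icc 1 m,
          (-1 : ℂ) ^ partMult P i /
              ((Nat.factorial (partMult P i) : ℂ) * (i : ℂ) ^ partMult P i) *
            riemannZeta (2 * (i : ℂ)) ^ partMult P i =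
        partitionExpSum (fun k : ℕ => -riemannZeta (2 * (k : ℂ)) / k) m := by
      refine sum_congr rfl fun P _ => prod_congr rfl fun i _ => ?_
      rw [partMult, div_pow, neg_pow (riemannZeta _)]
      ring
    rw [h, ← neg_one_pow_mul_esymmTsum_eq_partitionExpSum, ← mul_assoc, ← mul_pow,
      ofReal_multipleZeta_two]
    simp
  · have h := (ofReal_multipleZeta_two m).trans (esymmTsum_one_div_succ_sq m)
    exact_mod_cast h
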